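/- Let $G=(V,E)$ be a connected, locally finite simple graph with at least two vertices, and let $\Gamma$ be a closed subgroup of $\mathrm{Aut}(G)$ (with the topology of pointwise convergence) that acts transitively on $V$. For $x,y\in V$ let $$\mathbf w^{y}(x)=\frac{|\Gamma_x y|}{|\Gamma_y x|},$$ where $\Gamma_v$ is the stabilizer of $v$ in $\Gamma$. Fix a reference vertex $o\in V$ and write $\mathbf w^o(A)=\sum_{x\in A}\mathbf w^o(x)$ for $A\subseteq V$. Let $D=\sum_{z\sim o}\sqrt{\mathbf w^o(z)}$ and $c(x,y)=\sqrt{\mathbf w^o(x)\mathbf w^o(y)}/D$ for $x\sim y$, and let $$\Phi=\inf\Big\{\frac{c(\partial_E F)}{\mathbf w^o(F)} : \emptyset\ne F\subseteq V,\ \mathbf w^o(F)<\infty\Big\},$$ where $\partial_E F$ is the set of edges with exactly one endpoint in $F$ and $c(\partial_E F)$ is the sum of $c$ over these edges. The graph $G$ is called $\mathbf w$-amenable if $$\inf\Big\{\frac{\mathbf w^o(\partial_V F)}{\mathbf w^o(F)} : \emptyset\neq F\subseteq V \text{ finite}\Big\}=0,$$ where $\partial_V F$ is the set of vertices outside $F$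 with a neighbor in $F$. The $\sqrt{\mathbf w}$-biased random walk on $G$ is the nearest-neighbor walk with transition probabilities $$p(x,y)=\frac{\sqrt{\mathbf w^o(x)\mathbf w^o(y)}}{\sum_{z\sim x}\sqrt{\mathbf w^o(x)\mathbf w^o(z)}}\quad (x\sim y).$$ Let $p_n$ be its $n$-step transition probabilities and $\rho=\limsup_{n\to\infty}p_{2n}(x,x)^{1/(2n)}$ its spectral radius, for a starting vertex $x\in V$. Then $p$ is a stochastic kernel that is reversible with respect to $\mathbf w^o$, that is, $\mathbf w^o(x)p(x,y)=\mathbf w^o(y)p(y,x)$ for all $x,y\in V$, and for every starting vertex $x$ $$\tfrac12\Phi^2\le 1-\sqrt{1-\Phi^2}\le 1-\rho\le\Phi .$$ In particular, $\rho=1$ if and only if $G$ is $\mathbf w$-amenable. -/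

import Mathlib

open Filter Topology

noncomputable section

namespace WeightedKesten

variable {V : Type*} {G : SimpleGraph V}

/-- The topology of pointwise convergence on `Aut(G)`, the vertex set being discrete. -/
@[reducible] def autTopology (G : SimpleGraph V) : TopologicalSpace (G ≃g G) :=
  TopologicalSpace.induced (fun (γ : G ≃g G) (v : V) => γ v)
    (@Pi.topologicalSpace V (fun _ => V) (fun _ => ⊥))

/-- The relative weight `w^y(x) = |Γ_x y| / |Γ_y x|`, where `Γ_v` is the stabilizer of `v` in `Γ`.
(For `G` connected and locally finite both orbits are finite.) -/
def relWeight (Γ : Subgroup (G ≃g G)) (y x : V) : ℝ :=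
  (Nat.card (MulAction.orbit (MulAction.stabilizer Γ x) y) : ℝ) /
    (Nat.card (MulAction.orbit (MulAction.stabilizer Γ y) x) : ℝ)

/-- `w^o(A) = ∑_{x ∈ A} w^o(x)`; used for sets of finite weight only. -/
def setWeight (Γ : Subgroup (G ≃g G)) (o : V) (A : Set V) : ℝ :=
  ∑' x : A, relWeight Γ o x

/-- `A` is light: its total weight is finite. -/
def IsLight (Γ : Subgroup (G ≃g G)) (o : V) (A : Set V) : Prop :=
  Summable fun x : A => relWeight Γ o x

/-- The external vertex boundary of `F`. -/
def vertexBoundary (G : SimpleGraph V) (F : Set V) : Set V :=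
  {y | y ∉ F ∧ ∃ x ∈ F, G.Adj x y}

/-- The edge boundary of `F`; every edge with exactly one endpoint in `F` is listed once, as the
ordered pair `(x, y)` with `x ∈ F` and `y ∉ F`. -/
def edgeBoundary (G : SimpleGraph V) (F : Set V) : Set (V × V) :=
  {e | e.1 ∈ F ∧ e.2 ∉ F ∧ G.Adj e.1 e.2}

/-- The weighted vertex isoperimetric constant: the infimum of `w^o(∂_V F) / w^o(F)` over the
nonempty finite sets `F` of vertices. -/
def vertexExpansion (Γ : Subgroup (G ≃g G)) (o : V) : ℝ :=
  ⨅ F : {F : Set V // F.Finite ∧ F.Nonempty},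
    setWeight Γ o (vertexBoundary G F.1) / setWeight Γ o F.1

/-- `G` is `w`-amenable with respect to the action of `Γ` (with reference vertex `o`). -/
def WAmenable (Γ : Subgroup (G ≃g G)) (o : V) : Prop :=
  vertexExpansion Γ o = 0

section LocallyFinite

variable [G.LocallyFinite]

/-- The `√w`-degree `D = ∑_{z ∼ o} √(w^o(z))`. -/
def sqrtDegree (Γ : Subgroup (G ≃g G)) (o : V) : ℝ :=
  ∑ z ∈ G.neighborFinset o, √(relWeight Γ o z)

/-- The conductance `c(x,y) = √(w^o(x) w^o(y)) / D` of an edge `{x, y}` of `G`. -/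
def conductance (Γ : Subgroup (G ≃g G)) (o x y : V) : ℝ :=
  √(relWeight Γ o x * relWeight Γ o y) / sqrtDegree Γ o

/-- The weighted edge-expansion constant: the infimum of `c(∂_E F) / w^o(F)` over the
nonempty sets `F` of vertices (finite or infinite) of finite total weight. -/
def edgeExpansion (Γ : Subgroup (G ≃g G)) (o : V) : ℝ :=
  ⨅ F : {F : Set V // F.Nonempty ∧ IsLight Γ o F},
    (∑' e : edgeBoundary G F.1, conductance Γ o e.1.1 e.1.2) / setWeight Γ o F.1

open Classical in
/-- One-step transition probabilities of the `√w`-biased random walk: from `x` it moves to a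
neighbor `y` of `x` with probability proportional to `√(w^o(x) w^o(y))`. -/
def stepProb (Γ : Subgroup (G ≃g G)) (o x y : V) : ℝ :=
  if G.Adj x y then
    √(relWeight Γ o x * relWeight Γ o y) /
      ∑ z ∈ G.neighborFinset x, √(relWeight Γ o x * relWeight Γ o z)
  else 0

open Classical in
/-- The `n`-step transition probabilities `p_n(x,y) = P_x(X_n = y)` of the `√w`-biased walk. -/
def nStepProb (Γ : Subgroup (G ≃g G)) (o : V) : ℕ → V → V → ℝ
  | 0, x, y => if x = y then 1 else 0
  | n + 1, x, y => ∑ z ∈ G.neighborFinset x, stepProb Γ o x z * nStepProb Γ o n z y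

/-- The spectral radius `limsup_n p_{2n}(x,x)^{1/(2n)}` of the `√w`-biased walk started at `x`. -/
def spectralRadius (Γ : Subgroup (G ≃g G)) (o x : V) : ℝ :=
  limsup (fun n : ℕ => nStepProb Γ o (2 * n) x x ^ (1 / (2 * (n : ℝ)))) atTop

end LocallyFinite

end WeightedKesten

end

noncomputable section

namespace WeightedKesten

/-! ### The relative weight as a cocycle of the action. -/

section

variable {V : Type*} {G : SimpleGraph V}

/-! Vertex stabilizers are pairwise commensurable, so the relative weights are positive and satisfy
the cocycle identity `relWeight_mul_relWeight`. Hence each `γ` in `Γ` multiplies `w^o` by a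
constant. By transitivity the conductances at `x` then sum to exactly `w^o(x)`: the walk is
reversible and `Γ`-invariant, and its return probabilities do not depend on the starting vertex.

Let `P` be the Markov operator on finitely supported functions, symmetric for the form with weight
`w = w^o`. For finite `F` the boundary conductance is `w(F)` minus the sum of `c` over `F × F`;
infinite light sets do not lower the infimum, by finite approximation
(`IsConductance.mul_tsum_le_tsum_edgeBoundary`).

Upper bound on `ρ`: the co-area inequality and Cauchy-Schwarz (`IsConductance.cheeger`) give `|⟨f,
Pf⟩| ≤ √(1 - Φ²) ⟨f, f⟩`, and iterating bounds `w(x) p_{2n}(x,x) = ‖P^n δ_x‖²`.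

Lower bound: the indicator of a finite `F` has Rayleigh quotient `r = 1 - c(∂F)/w(F)`. If `r > 0`,
then `‖P^n 1_F‖² ≥ r^{2n} w(F)`, while `‖P^n 1_F‖² ≤ |F| ∑_{x ∈ F} ‖P^n δ_x‖² = |F| w(F)
p_{2n}(o,o)`. Taking roots gives `ρ ≥ r`.

Finally, step probabilities along edges are bounded below, so edge and vertex boundaries are
comparable and `Φ = 0` is equivalent to amenability. -/

theorem card_orbit_stabilizer (Γ : Subgroup (G ≃g G)) (x y : V) :
    Nat.card (MulAction.orbit (MulAction.stabilizer Γ x) y) =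
      (MulAction.stabilizer Γ y).relIndex (MulAction.stabilizer Γ x) := by
  rw [Subgroup.relIndex, Nat.card_congr
    (MulAction.orbitEquivQuotientStabilizer (MulAction.stabilizer Γ x) y), ← Subgroup.index]
  congr 1

theorem relIndex_stabilizer_ne_zero_of_adj [G.LocallyFinite] (Γ : Subgroup (G ≃g G)) {x y : V}
    (h : G.Adj x y) :
    (MulAction.stabilizer Γ y).relIndex (MulAction.stabilizer Γ x) ≠ 0 := by
  rw [← card_orbit_stabilizer]
  have hsub : MulAction.orbit (MulAction.stabilizer Γ x) y ⊆ (G.neighborFinset x : Set V) := by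
    rintro _ ⟨⟨γ, hγ⟩, rfl⟩
    rw [Finset.mem_coe, SimpleGraph.mem_neighborFinset]
    have hx : (γ : G ≃g G) x = x := hγ
    have := (γ : G ≃g G).map_adj_iff.2 h
    rw [hx] at this
    exact this
  have hfin := (Finset.finite_toSet _).subset hsub
  have : Finite (MulAction.orbit (MulAction.stabilizer Γ x) y) := hfin
  have : Nonempty (MulAction.orbit (MulAction.stabilizer Γ x) y) :=
    ⟨⟨y, MulAction.mem_orbit_self y⟩⟩
  exact Nat.card_pos.ne'

/-- For adjacent vertices the orbit of one under the stabilizer of the other stays among finitely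
many neighbors; commensurability then propagates along a walk. -/
theorem commensurable_stabilizer [G.LocallyFinite] (hG : G.Connected) (Γ : Subgroup (G ≃g G))
    (x y : V) :
    Subgroup.Commensurable (MulAction.stabilizer Γ x) (MulAction.stabilizer Γ y) := by
  obtain ⟨q⟩ := hG.preconnected x y
  induction q with
  | nil => exact Subgroup.Commensurable.refl _
  | cons h _ ih =>
    exact Subgroup.Commensurable.trans
      ⟨relIndex_stabilizer_ne_zero_of_adj Γ h.symm, relIndex_stabilizer_ne_zero_of_adj Γ h⟩ ih

theorem relWeight_pos [G.LocallyFinite] (hG : G.Connected) (Γ : Subgroup (G ≃g G)) (y x : V) :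
    0 < relWeight Γ y x := by
  have h := commensurable_stabilizer hG Γ x y
  rw [relWeight, card_orbit_stabilizer, card_orbit_stabilizer]
  exact div_pos (Nat.cast_pos.2 (Nat.pos_of_ne_zero h.2)) (Nat.cast_pos.2 (Nat.pos_of_ne_zero h.1))

/-- Both indices are compared with one subgroup that is symmetric in `x`, `y`, `z`, which turns the
cocycle identity into a cancellation of fractions. -/
theorem relWeight_eq_div_relIndex [G.LocallyFinite] (hG : G.Connected) (Γ : Subgroup (G ≃g G))
    (y x z : V) :
    relWeight Γ y x =
      ((MulAction.stabilizer Γ x ⊓ MulAction.stabilizer Γ y ⊓ MulAction.stabilizer Γ z).relIndex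
          (MulAction.stabilizer Γ x) : ℝ) /
        ((MulAction.stabilizer Γ x ⊓ MulAction.stabilizer Γ y ⊓ MulAction.stabilizer Γ z).relIndex
          (MulAction.stabilizer Γ y) : ℝ) := by
  rw [relWeight, card_orbit_stabilizer, card_orbit_stabilizer]
  have hx := commensurable_stabilizer hG Γ z x
  have hy := commensurable_stabilizer hG Γ z y
  set H := MulAction.stabilizer Γ x
  set K := MulAction.stabilizer Γ y
  set L := MulAction.stabilizer Γ z
  have h1 : (H ⊓ K ⊓ L).relIndex H = L.relIndex (K ⊓ H) * K.relIndex H := by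
    rw [Subgroup.relIndex_inf_mul_relIndex, ← Subgroup.inf_relIndex_right (L ⊓ K)]
    congr 1
    ac_rfl
  have h2 : (H ⊓ K ⊓ L).relIndex K = L.relIndex (K ⊓ H) * H.relIndex K := by
    rw [inf_comm K H, Subgroup.relIndex_inf_mul_relIndex, ← Subgroup.inf_relIndex_right (L ⊓ H)]
    congr 1
    ac_rfl
  -- `relIndex` is `0` for infinite index; commensurability excludes this.
  have h0 : L.relIndex (K ⊓ H) ≠ 0 := by
    intro h
    have := Subgroup.relIndex_eq_zero_of_le_right (inf_le_right : K ⊓ H ≤ H) h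
    exact hx.1 this
  rw [h1, h2, Nat.cast_mul, Nat.cast_mul, mul_div_mul_left _ _ (Nat.cast_ne_zero.2 h0)]

theorem relWeight_mul_relWeight [G.LocallyFinite] (hG : G.Connected) (Γ : Subgroup (G ≃g G))
    (x y z : V) : relWeight Γ z y * relWeight Γ y x = relWeight Γ z x := by
  have hp := relWeight_pos hG Γ y x
  rw [relWeight_eq_div_relIndex hG Γ y x z] at hp ⊢
  rw [relWeight_eq_div_relIndex hG Γ z y x, relWeight_eq_div_relIndex hG Γ z x y]
  have e1 : MulAction.stabilizer Γ y ⊓ MulAction.stabilizer Γ z ⊓ MulAction.stabilizer Γ x =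
    MulAction.stabilizer Γ x ⊓ MulAction.stabilizer Γ y ⊓ MulAction.stabilizer Γ z := by ac_rfl
  have e2 : MulAction.stabilizer Γ x ⊓ MulAction.stabilizer Γ z ⊓ MulAction.stabilizer Γ y =
    MulAction.stabilizer Γ x ⊓ MulAction.stabilizer Γ y ⊓ MulAction.stabilizer Γ z := by ac_rfl
  rw [e1, e2, mul_comm]
  refine div_mul_div_cancel₀ ?_
  intro h
  rw [h, div_zero] at hp
  exact hp.false

theorem card_orbit_stabilizer_smul (Γ : Subgroup (G ≃g G)) (γ : Γ) (x y : V) :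
    Nat.card (MulAction.orbit (MulAction.stabilizer Γ (γ • x)) (γ • y)) =
      Nat.card (MulAction.orbit (MulAction.stabilizer Γ x) y) := by
  have himg : MulAction.orbit (MulAction.stabilizer Γ (γ • x)) (γ • y) =
      (fun v => γ • v) '' MulAction.orbit (MulAction.stabilizer Γ x) y := by
    ext v
    constructor
    · rintro ⟨⟨g, hg⟩, rfl⟩
      rw [MulAction.mem_stabilizer_iff] at hg
      refine ⟨(γ⁻¹ * g * γ) • y, ⟨⟨γ⁻¹ * g * γ, ?_⟩, rfl⟩, ?_⟩
      · rw [MulAction.mem_stabilizer_iff, mul_smul, mul_smul, hg, inv_smul_smul]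
      · change γ • (γ⁻¹ * g * γ) • y = g • γ • y
        rw [smul_smul, smul_smul]
        congr 1
        group
    · rintro ⟨_, ⟨⟨g, hg⟩, rfl⟩, rfl⟩
      rw [MulAction.mem_stabilizer_iff] at hg
      refine ⟨⟨γ * g * γ⁻¹, ?_⟩, ?_⟩
      · rw [MulAction.mem_stabilizer_iff, mul_smul, mul_smul, inv_smul_smul, hg]
      · change (γ * g * γ⁻¹) • γ • y = γ • g • y
        rw [smul_smul, smul_smul]
        congr 1
        group
  rw [himg, Nat.card_image_of_injective (MulAction.injective γ)]

theorem relWeight_smul_smul (Γ : Subgroup (G ≃g G)) (γ : Γ) (x y : V) :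
    relWeight Γ (γ • y) (γ • x) = relWeight Γ y x := by
  rw [relWeight, relWeight, card_orbit_stabilizer_smul, card_orbit_stabilizer_smul]

/-- Written without division: the ratio of `w^o(γ z)` to `w^o(z)` does not depend on `z`. -/
theorem relWeight_smul [G.LocallyFinite] (hG : G.Connected) (Γ : Subgroup (G ≃g G)) (γ : Γ)
    (o x z : V) :
    relWeight Γ o (γ • z) * relWeight Γ o x = relWeight Γ o (γ • x) * relWeight Γ o z := by
  have h1 := relWeight_mul_relWeight hG Γ (γ • z) (γ • x) o
  have h2 := relWeight_mul_relWeight hG Γ z x o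
  rw [relWeight_smul_smul] at h1
  rw [← h1, ← h2]
  ring

theorem neighborFinset_smul [G.LocallyFinite] (Γ : Subgroup (G ≃g G)) (γ : Γ) (x : V) :
    G.neighborFinset (γ • x) =
      (G.neighborFinset x).map ⟨fun v => γ • v, MulAction.injective γ⟩ := by
  ext v
  simp only [SimpleGraph.mem_neighborFinset, Finset.mem_map, Function.Embedding.coeFn_mk]
  constructor
  · intro h
    refine ⟨γ⁻¹ • v, ?_, smul_inv_smul γ v⟩
    refine (γ : G ≃g G).map_adj_iff.1 ?_
    change G.Adj (γ • x) (γ • γ⁻¹ • v)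
    rwa [smul_inv_smul]
  · rintro ⟨u, hu, rfl⟩
    exact (γ : G ≃g G).map_adj_iff.2 hu

theorem adj_smul_smul (Γ : Subgroup (G ≃g G)) (γ : Γ) (x y : V) :
    G.Adj (γ • x) (γ • y) ↔ G.Adj x y := (γ : G ≃g G).map_adj_iff

theorem setWeight_coe (Γ : Subgroup (G ≃g G)) (o : V) (F : Finset V) :
    setWeight Γ o (F : Set V) = ∑ x ∈ F, relWeight Γ o x :=
  Finset.tsum_subtype' F _

end

section

/-! ### Powers of an operator symmetric for a bilinear form. -/

section SelfAdjoint

variable {E : Type*} [AddCommGroup E] [Module ℝ E] {B : LinearMap.BilinForm ℝ E} {P : E →ₗ[ℝ] E}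

/-- Polarization: the upper bound at `f + g` and the lower bound at `f - g` control `B (P f) g`, so
both signs in the absolute value are needed. -/
theorem form_apply_self_le_of_quadratic_le (hB : LinearMap.IsSymm B)
    (hP : ∀ f g, B (P f) g = B f (P g)) {κ : ℝ} (hκ : 0 ≤ κ)
    (h : ∀ f, |B f (P f)| ≤ κ * B f f) (f : E) : B (P f) (P f) ≤ κ ^ 2 * B f f := by
  have key : ∀ g, 2 * B (P f) g ≤ κ * (B f f + B g g) := by
    intro g
    have h1 := (abs_le.1 (h (f + g))).2
    have h2 := (abs_le.1 (h (f - g))).1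
    have e1 : B g (P f) = B (P f) g := hB.eq _ _
    have e2 : B g f = B f g := hB.eq _ _
    simp only [map_add, map_sub, LinearMap.add_apply, LinearMap.sub_apply] at h1 h2
    rw [← hP f g, e1, e2] at h1 h2
    linarith
  rcases hκ.eq_or_lt with h0 | hpos
  · have := key (P f)
    rw [← h0] at this ⊢
    linarith
  -- This multiple of `P f` optimizes the polarized inequality.
  · have := key (κ⁻¹ • P f)
    simp only [map_smul, LinearMap.smul_apply, smul_eq_mul] at this
    have e : κ * (B f f + κ⁻¹ * (κ⁻¹ * B (P f) (P f))) = κ * B f f + κ⁻¹ * B (P f) (P f) := by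
      field_simp
    rw [e] at this
    have h3 : κ⁻¹ * B (P f) (P f) ≤ κ * B f f := by linarith
    calc B (P f) (P f) = κ * (κ⁻¹ * B (P f) (P f)) := by field_simp
      _ ≤ κ * (κ * B f f) := mul_le_mul_of_nonneg_left h3 hκ
      _ = κ ^ 2 * B f f := by ring

theorem form_pow_apply_self_le (hB : LinearMap.IsSymm B)
    (hP : ∀ f g, B (P f) g = B f (P g)) {κ : ℝ} (hκ : 0 ≤ κ)
    (h : ∀ f, |B f (P f)| ≤ κ * B f f) (f : E) (n : ℕ) :
    B ((P ^ n) f) ((P ^ n) f) ≤ κ ^ (2 * n) * B f f := by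
  induction n with
  | zero => simp
  | succ n ih =>
    rw [pow_succ', Module.End.mul_apply]
    calc _ ≤ κ ^ 2 * B ((P ^ n) f) ((P ^ n) f) :=
          form_apply_self_le_of_quadratic_le hB hP hκ h _
      _ ≤ κ ^ 2 * (κ ^ (2 * n) * B f f) := mul_le_mul_of_nonneg_left ih (sq_nonneg κ)
      _ = κ ^ (2 * (n + 1)) * B f f := by ring

/-- By Cauchy-Schwarz the sequence `B (P^n f) (P^n f)` is log-convex, so its successive ratios never
fall below the first, which is at least `r ^ 2`. -/
theorem le_form_pow_apply_self (hs : ∀ f, 0 ≤ B f f) (hB : LinearMap.IsSymm B)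
    (hP : ∀ f g, B (P f) g = B f (P g)) {f : E} (hf : 0 < B f f) {r : ℝ} (hr : 0 < r)
    (h : r * B f f ≤ B f (P f)) (n : ℕ) :
    r ^ (2 * n) * B f f ≤ B ((P ^ n) f) ((P ^ n) f) := by
  have step : ∀ n, 0 < B ((P ^ n) f) ((P ^ n) f) ∧ r ^ 2 * B ((P ^ n) f) ((P ^ n) f) ≤
      B ((P ^ (n + 1)) f) ((P ^ (n + 1)) f) := by
    intro n
    induction n with
    | zero =>
      refine ⟨hf, ?_⟩
      simp only [zero_add, pow_one, pow_zero, Module.End.one_apply]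
      have hcs := B.apply_sq_le_of_symm hs hB f (P f)
      have hsq : (r * B f f) ^ 2 ≤ B f (P f) ^ 2 :=
        pow_le_pow_left₀ (mul_pos hr hf).le h 2
      refine le_of_mul_le_mul_left ?_ hf
      calc B f f * (r ^ 2 * B f f) = (r * B f f) ^ 2 := by ring
        _ ≤ _ := hsq.trans hcs
    | succ n ih =>
      obtain ⟨h1, h2⟩ := ih
      have h3 : 0 < B ((P ^ (n + 1)) f) ((P ^ (n + 1)) f) :=
        (mul_pos (pow_pos hr 2) h1).trans_le h2
      refine ⟨h3, ?_⟩
      have hcs := B.apply_sq_le_of_symm hs hB ((P ^ n) f) ((P ^ (n + 2)) f)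
      have e : B ((P ^ n) f) ((P ^ (n + 2)) f) = B ((P ^ (n + 1)) f) ((P ^ (n + 1)) f) := by
        rw [pow_succ' P (n + 1), Module.End.mul_apply, ← hP, ← Module.End.mul_apply, ← pow_succ']
      rw [e] at hcs
      refine le_of_mul_le_mul_left ?_ h1
      calc _ = (r ^ 2 * B ((P ^ n) f) ((P ^ n) f)) * B ((P ^ (n + 1)) f) ((P ^ (n + 1)) f) := by
            ring
        _ ≤ B ((P ^ (n + 1)) f) ((P ^ (n + 1)) f) * B ((P ^ (n + 1)) f) ((P ^ (n + 1)) f) :=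
            mul_le_mul_of_nonneg_right h2 h3.le
        _ ≤ _ := by rw [← sq]; exact hcs
  induction n with
  | zero => simp
  | succ n ih =>
    calc _ = r ^ 2 * (r ^ (2 * n) * B f f) := by ring
      _ ≤ r ^ 2 * B ((P ^ n) f) ((P ^ n) f) := mul_le_mul_of_nonneg_left ih (sq_nonneg r)
      _ ≤ _ := (step n).2

theorem form_pow_apply_pow_apply (hP : ∀ f g, B (P f) g = B f (P g)) (f g : E) (n : ℕ) :
    B ((P ^ n) f) ((P ^ n) g) = B f ((P ^ (2 * n)) g) := by
  have : ∀ n g, B ((P ^ n) f) g = B f ((P ^ n) g) := by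
    intro n
    induction n with
    | zero => simp
    | succ n ih =>
      intro g
      rw [pow_succ', Module.End.mul_apply, hP, ih, ← Module.End.mul_apply, ← pow_succ, pow_succ']
  rw [this, ← Module.End.mul_apply, ← pow_add, two_mul]

end SelfAdjoint

/-! ### Exponential growth rates of return probabilities. -/

section Limsup

variable {a : ℕ → ℝ}

theorem rpow_one_div_two_mul_pow {r : ℝ} (hr : 0 ≤ r) {n : ℕ} (hn : n ≠ 0) :
    (r ^ (2 * n)) ^ (1 / (2 * (n : ℝ))) = r := by
  have h := Real.pow_rpow_inv_natCast hr (n := 2 * n) (by omega)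
  rwa [Nat.cast_mul, Nat.cast_ofNat, ← one_div] at h

theorem rpow_root_le {κ : ℝ} (hκ : 0 ≤ κ) (h0 : ∀ n, 0 ≤ a n)
    (h : ∀ n, a n ≤ κ ^ (2 * n)) {n : ℕ} (hn : n ≠ 0) : a n ^ (1 / (2 * (n : ℝ))) ≤ κ := by
  calc _ ≤ (κ ^ (2 * n)) ^ (1 / (2 * (n : ℝ))) :=
        Real.rpow_le_rpow (h0 n) (h n) (by positivity)
    _ = κ := rpow_one_div_two_mul_pow hκ hn

theorem isCoboundedUnder_root (h0 : ∀ n, 0 ≤ a n) :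
    IsCoboundedUnder (· ≤ ·) atTop fun n : ℕ => a n ^ (1 / (2 * (n : ℝ))) :=
  IsBoundedUnder.isCoboundedUnder_le
    ⟨0, eventually_map.2 (Eventually.of_forall fun n => Real.rpow_nonneg (h0 n) _)⟩

theorem limsup_root_le {κ : ℝ} (hκ : 0 ≤ κ) (h0 : ∀ n, 0 ≤ a n)
    (h : ∀ n, a n ≤ κ ^ (2 * n)) :
    limsup (fun n : ℕ => a n ^ (1 / (2 * (n : ℝ)))) atTop ≤ κ := by
  refine limsup_le_of_le (isCoboundedUnder_root h0) ?_
  filter_upwards [eventually_ne_atTop 0] with n hn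
  exact rpow_root_le hκ h0 h hn

/-- The roots of `C` tend to `1`. The bound by `κ` only keeps the sequence bounded above, so that
the real `limsup` is not a default value. -/
theorem le_limsup_root {κ : ℝ} (hκ : 0 ≤ κ) (h0 : ∀ n, 0 ≤ a n)
    (h : ∀ n, a n ≤ κ ^ (2 * n)) {r C : ℝ} (hr : 0 ≤ r) (hC : 0 < C)
    (hle : ∀ n, C * r ^ (2 * n) ≤ a n) :
    r ≤ limsup (fun n : ℕ => a n ^ (1 / (2 * (n : ℝ)))) atTop := by
  have hlim : Tendsto (fun n : ℕ => C ^ (1 / (2 * (n : ℝ))) * r) atTop (𝓝 r) := by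
    have h1 : Tendsto (fun n : ℕ => 1 / (2 * (n : ℝ))) atTop (𝓝 0) := by
      have := (tendsto_one_div_atTop_nhds_zero_nat (𝕜 := ℝ)).const_mul (1 / 2)
      rw [mul_zero] at this
      refine this.congr fun n => ?_
      rw [one_div_mul_one_div]
    have h2 := ((tendsto_const_nhds (x := C)).rpow h1 (Or.inl hC.ne')).mul_const r
    rwa [Real.rpow_zero, one_mul] at h2
  rw [← hlim.limsup_eq]
  refine limsup_le_limsup ?_ hlim.isBoundedUnder_ge.isCoboundedUnder_le ?_
  -- At `n = 0` the exponent `1 / 0` is `0`, so that term is left out.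
  · filter_upwards [eventually_ne_atTop 0] with n hn
    calc _ = (C * r ^ (2 * n)) ^ (1 / (2 * (n : ℝ))) := by
          rw [Real.mul_rpow hC.le (by positivity), rpow_one_div_two_mul_pow hr hn]
      _ ≤ _ := Real.rpow_le_rpow (by positivity) (hle n) (by positivity)
  · refine ⟨κ, ?_⟩
    rw [eventually_map]
    filter_upwards [eventually_ne_atTop 0] with n hn
    exact rpow_root_le hκ h0 h hn

end Limsup

/-! ### Co-area and Cheeger inequalities for conductances. -/

variable {V : Type*} {G : SimpleGraph V}

/-- `c` is a symmetric system of conductances on the edges of `G` whose total conductance at each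
vertex is given by the positive weight `w`. -/
structure IsConductance (G : SimpleGraph V) [G.LocallyFinite] (w : V → ℝ) (c : V → V → ℝ) :
    Prop where
  weight_pos : ∀ x, 0 < w x
  nonneg : ∀ x y, 0 ≤ c x y
  symm : ∀ x y, c x y = c y x
  eq_zero : ∀ x y, ¬ G.Adj x y → c x y = 0
  sum_eq : ∀ x, ∑ y ∈ G.neighborFinset x, c x y = w x

section Conductance

variable [G.LocallyFinite] {w : V → ℝ} {c : V → V → ℝ}

theorem IsConductance.sum_of_neighborFinset_subset (hc : IsConductance G w c) {x : V}
    {S : Finset V} (h : G.neighborFinset x ⊆ S) : ∑ y ∈ S, c x y = w x := by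
  rw [← hc.sum_eq x]
  refine (Finset.sum_subset h fun y _ hy => hc.eq_zero x y ?_).symm
  rwa [SimpleGraph.mem_neighborFinset] at hy

theorem IsConductance.sum_le (hc : IsConductance G w c) (x : V) (S : Finset V) :
    ∑ y ∈ S, c x y ≤ w x := by
  classical
  rw [← hc.sum_of_neighborFinset_subset (Finset.subset_union_right (s₁ := S))]
  exact Finset.sum_le_sum_of_subset_of_nonneg Finset.subset_union_left
    fun y _ _ => hc.nonneg x y

theorem IsConductance.sum_sum_mul_left (hc : IsConductance G w c) {T S : Finset V}
    (hTS : T ⊆ S) (hN : ∀ x ∈ T, G.neighborFinset x ⊆ S) {h : V → ℝ} (hh : ∀ x ∉ T, h x = 0) :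
    ∑ x ∈ S, ∑ y ∈ S, c x y * h x = ∑ x ∈ T, w x * h x := by
  rw [← Finset.sum_subset hTS (fun x _ hx => by simp [hh x hx])]
  refine Finset.sum_congr rfl fun x hx => ?_
  rw [← Finset.sum_mul, hc.sum_of_neighborFinset_subset (hN x hx)]

theorem IsConductance.sum_sum_mul_right (hc : IsConductance G w c) {T S : Finset V}
    (hTS : T ⊆ S) (hN : ∀ x ∈ T, G.neighborFinset x ⊆ S) {h : V → ℝ} (hh : ∀ x ∉ T, h x = 0) :
    ∑ x ∈ S, ∑ y ∈ S, c x y * h y = ∑ x ∈ T, w x * h x := by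
  rw [← hc.sum_sum_mul_left hTS hN hh, Finset.sum_comm]
  simp_rw [hc.symm]

open Classical in
/-- The weighted co-area inequality. -/
theorem IsConductance.coarea (hc : IsConductance G w c) {Φ : ℝ}
    (hΦ : ∀ F : Finset V, Φ * ∑ x ∈ F, w x ≤ ∑ x ∈ F, w x - ∑ x ∈ F, ∑ y ∈ F, c x y)
    (T S : Finset V) (hTS : T ⊆ S) (hN : ∀ x ∈ T, G.neighborFinset x ⊆ S) (h : V → ℝ)
    (h0 : ∀ x, 0 ≤ h x) (hh : ∀ x ∉ T, h x = 0) :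
    2 * Φ * ∑ x ∈ T, w x * h x ≤ ∑ x ∈ S, ∑ y ∈ S, c x y * |h x - h y| := by
  induction hn : T.card generalizing T h with
  | zero =>
    rw [Finset.card_eq_zero] at hn
    subst hn
    rw [Finset.sum_empty, mul_zero]
    exact Finset.sum_nonneg fun x _ => Finset.sum_nonneg fun y _ =>
      mul_nonneg (hc.nonneg x y) (abs_nonneg _)
  | succ n ih =>
    have hne : T.Nonempty := by
      rw [← Finset.card_pos]
      omega
    obtain ⟨x₀, hx₀, hmin⟩ := T.exists_min_image h hne
    set m := h x₀
    -- Peel off the lowest level of `h`: the remainder `k = h - m e` vanishes at the minimizer `x₀`,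
    -- so its support is smaller.
    let e : V → ℝ := fun x => if x ∈ T then 1 else 0
    let k : V → ℝ := fun x => h x - m * e x
    have he : ∀ x ∈ T, e x = 1 := fun x hx => if_pos hx
    have he' : ∀ x ∉ T, e x = 0 := fun x hx => if_neg hx
    have hk0 : ∀ x, 0 ≤ k x := by
      intro x
      by_cases hx : x ∈ T
      · simp only [k, he x hx]
        linarith [hmin x hx]
      · simp only [k, he' x hx]
        linarith [h0 x]
    have hk' : ∀ x ∉ T, k x = 0 := fun x hx => by simp only [k, he' x hx, hh x hx]; ring
    have hk : ∀ x ∉ T.erase x₀, k x = 0 := by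
      intro x hx
      by_cases hxT : x ∈ T
      · obtain rfl : x = x₀ := by
          by_contra hne
          exact hx (Finset.mem_erase.2 ⟨hne, hxT⟩)
        simp only [k, he x hxT, m]
        ring
      · exact hk' x hxT
    have ih' := ih (T.erase x₀) ((Finset.erase_subset _ _).trans hTS)
      (fun x hx => hN x (Finset.mem_of_mem_erase hx)) k hk0 hk
      (by rw [Finset.card_erase_of_mem hx₀]; omega)
    rw [Finset.sum_erase _ (by rw [hk x₀ (by simp), mul_zero])] at ih'
    -- The factor of `m` is the indicator that exactly one of `x`, `y` lies in `T`; there the peeled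
    -- layer adds `m` to the difference.
    have habs : ∀ x y, |h x - h y| = |k x - k y| + m * (e x + e y - 2 * (e x * e y)) := by
      intro x y
      have hm : 0 ≤ m := h0 x₀
      by_cases hx : x ∈ T <;> by_cases hy : y ∈ T
      · simp only [k, he x hx, he y hy]
        ring_nf
      · have := hk0 x
        have e1 : h x - h y = k x + m := by
          simp only [k, he x hx, hh y hy]
          ring
        rw [e1, hk' y hy, sub_zero, abs_of_nonneg this, abs_of_nonneg (by linarith), he x hx,
          he' y hy]
        ring
      · have := hk0 y
        have e1 : h x - h y = -(k y + m) := by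
          simp only [k, he y hy, hh x hx]
          ring
        rw [e1, hk' x hx, zero_sub, abs_neg, abs_neg, abs_of_nonneg this,
          abs_of_nonneg (by linarith), he y hy, he' x hx]
        ring
      · rw [hh x hx, hh y hy, hk' x hx, hk' y hy, he' x hx, he' y hy]
        simp
    have hee : ∑ x ∈ S, ∑ y ∈ S, c x y * (e x * e y) = ∑ x ∈ T, ∑ y ∈ T, c x y := by
      rw [← Finset.sum_subset hTS (fun x _ hx => by simp [he' x hx])]
      refine Finset.sum_congr rfl fun x hx => ?_
      rw [← Finset.sum_subset hTS (fun y _ hy => by simp [he' y hy])]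
      refine Finset.sum_congr rfl fun y hy => ?_
      rw [he x hx, he y hy, mul_one, mul_one]
    have hwe : ∑ x ∈ T, w x * e x = ∑ x ∈ T, w x :=
      Finset.sum_congr rfl fun x hx => by rw [he x hx, mul_one]
    -- The factor `2` appears because ordered pairs count each boundary edge of `T` twice.
    have hsplit : ∑ x ∈ S, ∑ y ∈ S, c x y * |h x - h y| =
        ∑ x ∈ S, ∑ y ∈ S, c x y * |k x - k y| +
          m * (2 * (∑ x ∈ T, w x - ∑ x ∈ T, ∑ y ∈ T, c x y)) := by
      have e1 : ∀ x y, c x y * |h x - h y| = c x y * |k x - k y| + m * (c x y * e x) +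
          m * (c x y * e y) - 2 * m * (c x y * (e x * e y)) := fun x y => by rw [habs]; ring
      simp_rw [e1, Finset.sum_sub_distrib, Finset.sum_add_distrib, ← Finset.mul_sum]
      rw [hee, hc.sum_sum_mul_left hTS hN he', hc.sum_sum_mul_right hTS hN he', hwe]
      ring
    have hwh : ∑ x ∈ T, w x * h x = ∑ x ∈ T, w x * k x + m * ∑ x ∈ T, w x := by
      rw [← hwe, Finset.mul_sum, ← Finset.sum_add_distrib]
      exact Finset.sum_congr rfl fun x _ => by simp only [k]; ring
    rw [hsplit, hwh]
    have := mul_le_mul_of_nonneg_left (hΦ T) (h0 x₀)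
    linarith

/-- Cheeger's inequality for finitely supported functions. -/
theorem IsConductance.cheeger (hc : IsConductance G w c) {Φ : ℝ} (hΦ0 : 0 ≤ Φ)
    (hΦ : ∀ F : Finset V, Φ * ∑ x ∈ F, w x ≤ ∑ x ∈ F, w x - ∑ x ∈ F, ∑ y ∈ F, c x y)
    (T : Finset V) (f : V → ℝ) (hf : ∀ x ∉ T, f x = 0) :
    (∑ x ∈ T, ∑ y ∈ T, c x y * (f x * f y)) ^ 2 ≤
      (1 - Φ ^ 2) * (∑ x ∈ T, w x * f x ^ 2) ^ 2 := by
  classical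
  set S : Finset V := T ∪ T.biUnion fun x => G.neighborFinset x
  have hTS : T ⊆ S := Finset.subset_union_left
  have hN : ∀ x ∈ T, G.neighborFinset x ⊆ S := fun x hx =>
    (Finset.subset_biUnion_of_mem (fun x => G.neighborFinset x) hx).trans
      Finset.subset_union_right
  have hf2 : ∀ x ∉ T, f x ^ 2 = 0 := fun x hx => by rw [hf x hx]; ring
  set Q := ∑ x ∈ T, w x * f x ^ 2
  set R := ∑ x ∈ T, ∑ y ∈ T, c x y * (f x * f y)
  have hco := hc.coarea hΦ T S hTS hN (fun x => f x ^ 2) (fun x => sq_nonneg _) hf2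
  have hR : ∑ x ∈ S, ∑ y ∈ S, c x y * (f x * f y) = R := by
    rw [← Finset.sum_subset hTS (fun x _ hx => by simp [hf x hx])]
    refine Finset.sum_congr rfl fun x hx => ?_
    rw [← Finset.sum_subset hTS (fun y _ hy => by simp [hf y hy])]
  have hX : ∑ x ∈ S, ∑ y ∈ S, c x y * (f x - f y) ^ 2 = 2 * (Q - R) := by
    have e1 : ∀ x y, c x y * (f x - f y) ^ 2 = c x y * f x ^ 2 + c x y * f y ^ 2 -
      2 * (c x y * (f x * f y)) := fun x y => by ring
    simp_rw [e1, Finset.sum_sub_distrib, Finset.sum_add_distrib, ← Finset.mul_sum]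
    rw [hR, hc.sum_sum_mul_left hTS hN hf2, hc.sum_sum_mul_right hTS hN hf2]
    ring
  have hY : ∑ x ∈ S, ∑ y ∈ S, c x y * (f x + f y) ^ 2 = 2 * (Q + R) := by
    have e1 : ∀ x y, c x y * (f x + f y) ^ 2 = c x y * f x ^ 2 + c x y * f y ^ 2 +
      2 * (c x y * (f x * f y)) := fun x y => by ring
    simp_rw [e1, Finset.sum_add_distrib, ← Finset.mul_sum]
    rw [hR, hc.sum_sum_mul_left hTS hN hf2, hc.sum_sum_mul_right hTS hN hf2]
    ring
  -- Factor the difference of squares and apply Cauchy-Schwarz. Keeping both factors gives `4 (Q -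
  -- R) (Q + R)`, hence the sharp constant `1 - Φ ^ 2` and a bound on `R` of either sign.
  have hcs : (∑ x ∈ S, ∑ y ∈ S, c x y * |f x ^ 2 - f y ^ 2|) ^ 2 ≤
      (∑ x ∈ S, ∑ y ∈ S, c x y * (f x - f y) ^ 2) *
        ∑ x ∈ S, ∑ y ∈ S, c x y * (f x + f y) ^ 2 := by
    simp_rw [← Finset.sum_product']
    refine Finset.sum_sq_le_sum_mul_sum_of_sq_le_mul _
      (fun e _ => mul_nonneg (hc.nonneg _ _) (sq_nonneg _))
      (fun e _ => mul_nonneg (hc.nonneg _ _) (sq_nonneg _)) fun e _ => ?_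
    rw [mul_pow, sq_abs]
    exact le_of_eq (by ring)
  have hQ : 0 ≤ Q := Finset.sum_nonneg fun x _ => mul_nonneg (hc.weight_pos x).le (sq_nonneg _)
  have h1 : (2 * Φ * Q) ^ 2 ≤ (∑ x ∈ S, ∑ y ∈ S, c x y * |f x ^ 2 - f y ^ 2|) ^ 2 :=
    pow_le_pow_left₀ (by positivity) hco 2
  rw [hX, hY] at hcs
  nlinarith

end Conductance

end

/-! ### The Markov operator and bounds on its return probabilities. -/

section

variable {V : Type*} {G : SimpleGraph V}

/-- The bilinear form `⟨f, g⟩ = ∑ x, w x * f x * g x` on finitely supported functions. -/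
def weightForm (w : V → ℝ) : LinearMap.BilinForm ℝ (V →₀ ℝ) :=
  Finsupp.linearCombination ℝ fun x => w x • (Finsupp.lapply x : (V →₀ ℝ) →ₗ[ℝ] ℝ)

theorem weightForm_single (w : V → ℝ) (x : V) (a : ℝ) (g : V →₀ ℝ) :
    weightForm w (Finsupp.single x a) g = a * (w x * g x) := by
  simp [weightForm]

theorem weightForm_apply (w : V → ℝ) (f g : V →₀ ℝ) :
    weightForm w f g = ∑ x ∈ f.support, f x * (w x * g x) := by
  rw [weightForm, Finsupp.linearCombination_apply, Finsupp.sum, LinearMap.sum_apply]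
  simp

theorem weightForm_symm (w : V → ℝ) : LinearMap.IsSymm (weightForm w) := by
  classical
  refine ⟨fun f g => ?_⟩
  change weightForm w f g = weightForm w g f
  rw [weightForm_apply, weightForm_apply,
    Finset.sum_subset (Finset.subset_union_left (s₂ := g.support)),
    Finset.sum_subset (Finset.subset_union_right (s₁ := f.support) (s₂ := g.support))]
  · exact Finset.sum_congr rfl fun x _ => by ring
  · intro x _ hx
    rw [Finsupp.notMem_support_iff.1 hx, zero_mul]
  · intro x _ hx
    rw [Finsupp.notMem_support_iff.1 hx, zero_mul]

theorem weightForm_apply_self (w : V → ℝ) (f : V →₀ ℝ) :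
    weightForm w f f = ∑ x ∈ f.support, w x * f x ^ 2 := by
  rw [weightForm_apply]
  exact Finset.sum_congr rfl fun x _ => by ring

theorem weightForm_apply_self_nonneg {w : V → ℝ} (hw : ∀ x, 0 < w x) (f : V →₀ ℝ) :
    0 ≤ weightForm w f f := by
  rw [weightForm_apply_self]
  exact Finset.sum_nonneg fun x _ => mul_nonneg (hw x).le (sq_nonneg _)

variable [G.LocallyFinite]

/-- The Markov operator `(P f) x = ∑ y ∼ x, p x y * f y` on finitely supported functions. -/
def markovOp (G : SimpleGraph V) [G.LocallyFinite] (p : V → V → ℝ) :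
    (V →₀ ℝ) →ₗ[ℝ] (V →₀ ℝ) :=
  Finsupp.linearCombination ℝ fun y => ∑ x ∈ G.neighborFinset y, Finsupp.single x (p x y)

open Classical in
theorem markovOp_single (p : V → V → ℝ) (y x : V) :
    markovOp G p (Finsupp.single y 1) x = if G.Adj x y then p x y else 0 := by
  rw [markovOp, Finsupp.linearCombination_single, one_smul, Finsupp.finsetSum_apply]
  simp [Finsupp.single_apply, G.adj_comm x y]

theorem markovOp_apply (p : V → V → ℝ) (f : V →₀ ℝ) (x : V) :
    markovOp G p f x = ∑ y ∈ G.neighborFinset x, p x y * f y := by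
  classical
  induction f using Finsupp.induction_linear with
  | zero => simp
  | add f g hf hg =>
    rw [map_add, Finsupp.add_apply, hf, hg, ← Finset.sum_add_distrib]
    exact Finset.sum_congr rfl fun y _ => by rw [Finsupp.add_apply, mul_add]
  | single y a =>
    have : Finsupp.single y a = a • Finsupp.single y (1 : ℝ) := by simp
    rw [this, map_smul, Finsupp.smul_apply, markovOp_single]
    simp [Finsupp.single_apply, mul_comm]

section Conductance

variable {w : V → ℝ} {c p : V → V → ℝ}

theorem IsConductance.weightForm_markovOp (hc : IsConductance G w c)
    (hp : ∀ x y, w x * p x y = c x y) (f g : V →₀ ℝ) :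
    weightForm w f (markovOp G p g) =
      ∑ x ∈ f.support, ∑ y ∈ g.support, c x y * (f x * g y) := by
  classical
  rw [weightForm_apply]
  refine Finset.sum_congr rfl fun x _ => ?_
  rw [markovOp_apply, Finset.mul_sum, Finset.mul_sum]
  have e : ∀ y, f x * (w x * (p x y * g y)) = c x y * (f x * g y) := fun y => by
    rw [← hp]
    ring
  simp_rw [e]
  rw [Finset.sum_subset (Finset.subset_union_left (s₂ := g.support)),
    Finset.sum_subset (Finset.subset_union_right (s₁ := G.neighborFinset x) (s₂ := g.support))]
  · intro y _ hy
    rw [Finsupp.notMem_support_iff.1 hy, mul_zero, mul_zero]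
  · intro y _ hy
    rw [SimpleGraph.mem_neighborFinset] at hy
    rw [hc.eq_zero x y hy, zero_mul]

theorem IsConductance.weightForm_markovOp_comm (hc : IsConductance G w c)
    (hp : ∀ x y, w x * p x y = c x y) (f g : V →₀ ℝ) :
    weightForm w (markovOp G p f) g = weightForm w f (markovOp G p g) := by
  have hs : weightForm w (markovOp G p f) g = weightForm w g (markovOp G p f) :=
    (weightForm_symm w).eq _ _
  rw [hs, hc.weightForm_markovOp hp, hc.weightForm_markovOp hp, Finset.sum_comm]
  refine Finset.sum_congr rfl fun x _ => Finset.sum_congr rfl fun y _ => ?_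
  rw [hc.symm, mul_comm (f x)]

theorem IsConductance.abs_weightForm_markovOp_le (hc : IsConductance G w c)
    (hp : ∀ x y, w x * p x y = c x y) {Φ : ℝ} (hΦ0 : 0 ≤ Φ) (hΦ1 : Φ ≤ 1)
    (hΦ : ∀ F : Finset V, Φ * ∑ x ∈ F, w x ≤ ∑ x ∈ F, w x - ∑ x ∈ F, ∑ y ∈ F, c x y)
    (f : V →₀ ℝ) :
    |weightForm w f (markovOp G p f)| ≤ √(1 - Φ ^ 2) * weightForm w f f := by
  have h1 : 0 ≤ 1 - Φ ^ 2 := by nlinarith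
  refine abs_le_of_sq_le_sq ?_
    (mul_nonneg (Real.sqrt_nonneg _) (weightForm_apply_self_nonneg hc.weight_pos f))
  rw [mul_pow, Real.sq_sqrt h1, hc.weightForm_markovOp hp, weightForm_apply_self]
  exact hc.cheeger hΦ0 hΦ f.support f fun x hx => Finsupp.notMem_support_iff.1 hx

/-- Half of the `2n` factors move across the form by symmetry, so even return probabilities become
squared norms. -/
theorem IsConductance.pow_markovOp_apply_self_mul (hc : IsConductance G w c)
    (hp : ∀ x y, w x * p x y = c x y) (x : V) (n : ℕ) :
    w x * (markovOp G p ^ (2 * n)) (Finsupp.single x 1) x =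
      weightForm w ((markovOp G p ^ n) (Finsupp.single x 1))
        ((markovOp G p ^ n) (Finsupp.single x 1)) := by
  rw [form_pow_apply_pow_apply (hc.weightForm_markovOp_comm hp), weightForm_single, one_mul]

theorem IsConductance.pow_markovOp_apply_self_nonneg (hc : IsConductance G w c)
    (hp : ∀ x y, w x * p x y = c x y) (x : V) (n : ℕ) :
    0 ≤ (markovOp G p ^ (2 * n)) (Finsupp.single x 1) x := by
  refine nonneg_of_mul_nonneg_right ?_ (hc.weight_pos x)
  rw [hc.pow_markovOp_apply_self_mul hp]
  exact weightForm_apply_self_nonneg hc.weight_pos _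

theorem IsConductance.pow_markovOp_apply_self_le (hc : IsConductance G w c)
    (hp : ∀ x y, w x * p x y = c x y) {Φ : ℝ} (hΦ0 : 0 ≤ Φ) (hΦ1 : Φ ≤ 1)
    (hΦ : ∀ F : Finset V, Φ * ∑ x ∈ F, w x ≤ ∑ x ∈ F, w x - ∑ x ∈ F, ∑ y ∈ F, c x y)
    (x : V) (n : ℕ) :
    (markovOp G p ^ (2 * n)) (Finsupp.single x 1) x ≤ √(1 - Φ ^ 2) ^ (2 * n) := by
  refine le_of_mul_le_mul_left ?_ (hc.weight_pos x)
  rw [hc.pow_markovOp_apply_self_mul hp]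
  refine (form_pow_apply_self_le (weightForm_symm w) (hc.weightForm_markovOp_comm hp)
    (Real.sqrt_nonneg _) (hc.abs_weightForm_markovOp_le hp hΦ0 hΦ1 hΦ) _ n).trans_eq ?_
  rw [weightForm_single, Finsupp.single_eq_same]
  ring

theorem weightForm_sum_self_le (hw : ∀ x, 0 < w x) {ι : Type*} (F : Finset ι)
    (u : ι → V →₀ ℝ) :
    weightForm w (∑ i ∈ F, u i) (∑ i ∈ F, u i) ≤ F.card * ∑ i ∈ F, weightForm w (u i) (u i) := by
  have h : ∀ i j, weightForm w (u i) (u j) ≤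
      (weightForm w (u i) (u i) + weightForm w (u j) (u j)) / 2 := by
    intro i j
    have h1 := weightForm_apply_self_nonneg hw (u i - u j)
    have h2 : weightForm w (u j) (u i) = weightForm w (u i) (u j) := (weightForm_symm w).eq _ _
    simp only [map_sub, LinearMap.sub_apply] at h1
    linarith
  simp only [map_sum, LinearMap.sum_apply]
  calc _ ≤ ∑ i ∈ F, ∑ j ∈ F, (weightForm w (u i) (u i) + weightForm w (u j) (u j)) / 2 :=
        Finset.sum_le_sum fun i _ => Finset.sum_le_sum fun j _ => h j i |>.trans_eq (by ring)
    _ = _ := by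
      simp_rw [← Finset.sum_div, Finset.sum_add_distrib, Finset.sum_const, nsmul_eq_mul,
        ← Finset.mul_sum]
      ring

/-- The return probabilities dominate a multiple of the powers of the Rayleigh quotient of any
finite set, provided that they do not depend on the starting vertex. -/
theorem IsConductance.exists_le_pow_markovOp_apply_self (hc : IsConductance G w c)
    (hp : ∀ x y, w x * p x y = c x y) (o : V)
    (hinv : ∀ x n, (markovOp G p ^ n) (Finsupp.single x 1) x =
      (markovOp G p ^ n) (Finsupp.single o 1) o)
    (F : Finset V) {r : ℝ} (hF : F.Nonempty) (hr : 0 < r)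
    (h : r * ∑ x ∈ F, w x ≤ ∑ x ∈ F, ∑ y ∈ F, c x y) :
    ∃ C > 0, ∀ n, C * r ^ (2 * n) ≤ (markovOp G p ^ (2 * n)) (Finsupp.single o 1) o := by
  set f : V →₀ ℝ := Finsupp.indicator F fun _ _ => 1
  have hfs : f = ∑ x ∈ F, Finsupp.single x 1 := by
    simp only [f, Finsupp.indicator_eq_sum_single]
  have hf : ∀ x ∈ F, f x = 1 := fun x hx => Finsupp.indicator_of_mem hx _
  have hsupp : f.support = F := by
    ext x
    by_cases hx : x ∈ F
    · simp [hx, hf x hx]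
    · simp [hx, f, Finsupp.indicator_of_notMem hx]
  have hff : weightForm w f f = ∑ x ∈ F, w x := by
    rw [weightForm_apply_self, hsupp]
    exact Finset.sum_congr rfl fun x hx => by rw [hf x hx]; ring
  have hfP : weightForm w f (markovOp G p f) = ∑ x ∈ F, ∑ y ∈ F, c x y := by
    rw [hc.weightForm_markovOp hp, hsupp]
    exact Finset.sum_congr rfl fun x hx => Finset.sum_congr rfl fun y hy => by
      rw [hf x hx, hf y hy]; ring
  have hW : 0 < ∑ x ∈ F, w x := Finset.sum_pos (fun x _ => hc.weight_pos x) hF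
  have hcard : (0 : ℝ) < F.card := Nat.cast_pos.2 hF.card_pos
  -- The cardinality comes from `weightForm_sum_self_le`; the weight of `F` occurs on both sides and
  -- cancels.
  refine ⟨1 / F.card, by positivity, fun n => ?_⟩
  have h1 := le_form_pow_apply_self (weightForm_apply_self_nonneg hc.weight_pos)
    (weightForm_symm w) (hc.weightForm_markovOp_comm hp) (f := f) (by rwa [hff]) hr
    (by rwa [hff, hfP]) n
  have h2 := weightForm_sum_self_le hc.weight_pos F
    fun x => (markovOp G p ^ n) (Finsupp.single x 1)
  rw [← map_sum, ← hfs] at h2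
  simp_rw [← hc.pow_markovOp_apply_self_mul hp, hinv] at h2
  rw [← Finset.sum_mul] at h2
  rw [hff] at h1
  have h3 := h1.trans h2
  refine le_of_mul_le_mul_left ?_ (mul_pos hcard hW)
  calc _ = r ^ (2 * n) * ∑ x ∈ F, w x := by field_simp
    _ ≤ _ := h3.trans_eq (by ring)

end Conductance

end

/-! ### Edge boundaries of light sets and vertex boundaries of finite sets. -/

section

variable {V : Type*} {G : SimpleGraph V} [G.LocallyFinite]

section Conductance

variable {w : V → ℝ} {c p : V → V → ℝ}

theorem IsConductance.summable_and_tsum_indicator_fst (hc : IsConductance G w c) {F : Set V}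
    (hF : Summable fun x : F => w x) :
    (Summable ({e : V × V | e.1 ∈ F}.indicator fun e => c e.1 e.2)) ∧
      ∑' e, {e : V × V | e.1 ∈ F}.indicator (fun e => c e.1 e.2) e = ∑' x : F, w x := by
  have hsec : ∀ x, HasSum (fun y => {e : V × V | e.1 ∈ F}.indicator (fun e => c e.1 e.2) (x, y))
      (F.indicator w x) := by
    intro x
    by_cases hx : x ∈ F
    · rw [Set.indicator_of_mem hx, ← hc.sum_eq x]
      have : (fun y => {e : V × V | e.1 ∈ F}.indicator (fun e => c e.1 e.2) (x, y)) = c x := by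
        ext y
        exact Set.indicator_of_mem (show (x, y) ∈ {e : V × V | e.1 ∈ F} from hx) _
      rw [this]
      refine hasSum_sum_of_ne_finset_zero fun y hy => hc.eq_zero x y ?_
      rwa [SimpleGraph.mem_neighborFinset] at hy
    · rw [Set.indicator_of_notMem hx]
      have : (fun y => {e : V × V | e.1 ∈ F}.indicator (fun e => c e.1 e.2) (x, y)) = 0 := by
        ext y
        exact Set.indicator_of_notMem (show (x, y) ∉ {e : V × V | e.1 ∈ F} from hx) _
      rw [this]
      exact hasSum_zero
  have hs : Summable ({e : V × V | e.1 ∈ F}.indicator fun e => c e.1 e.2) := by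
    rw [summable_prod_of_nonneg (fun e => Set.indicator_nonneg (fun e _ => hc.nonneg _ _) e)]
    refine ⟨fun x => (hsec x).summable, ?_⟩
    simp_rw [fun x => (hsec x).tsum_eq]
    exact summable_subtype_iff_indicator.1 hF
  refine ⟨hs, ?_⟩
  rw [hs.tsum_prod, tsum_subtype F w]
  exact tsum_congr fun x => (hsec x).tsum_eq

/-- Edges starting in `F` carry total conductance `w(F)`, and each of them either leaves `F` or
stays inside. -/
theorem IsConductance.tsum_edgeBoundary_add (hc : IsConductance G w c) {F : Set V}
    (hF : Summable fun x : F => w x) :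
    ∑' e : edgeBoundary G F, c e.1.1 e.1.2 +
      ∑' e, (F ×ˢ F).indicator (fun e : V × V => c e.1 e.2) e = ∑' x : F, w x := by
  obtain ⟨hs, ht⟩ := hc.summable_and_tsum_indicator_fst hF
  have hle : ∀ A : Set (V × V), A ⊆ {e | e.1 ∈ F} →
      Summable (A.indicator fun e : V × V => c e.1 e.2) := by
    intro A hA
    have := hs.indicator A
    rwa [Set.indicator_indicator, Set.inter_eq_left.2 hA] at this
  rw [← ht, tsum_subtype (edgeBoundary G F) fun e => c e.1 e.2,
    ← (hle _ fun e he => he.1).tsum_add (hle _ fun e he => he.1)]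
  refine tsum_congr fun e => ?_
  by_cases h1 : e.1 ∈ F <;> by_cases h2 : e.2 ∈ F <;> by_cases h3 : G.Adj e.1 e.2 <;>
    simp [Set.indicator, edgeBoundary, h1, h2, h3, hc.eq_zero _ _]

theorem IsConductance.tsum_edgeBoundary_coe (hc : IsConductance G w c) (F : Finset V) :
    ∑' e : edgeBoundary G (F : Set V), c e.1.1 e.1.2 =
      ∑ x ∈ F, w x - ∑ x ∈ F, ∑ y ∈ F, c x y := by
  have h := hc.tsum_edgeBoundary_add (F := (F : Set V)) (Summable.of_finite)
  rw [← Finset.coe_product, ← tsum_subtype, Finset.tsum_subtype' (F ×ˢ F) fun e => c e.1 e.2,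
    Finset.sum_product, Finset.tsum_subtype' F] at h
  exact eq_sub_of_add_eq h

/-- A finite partial sum of the conductances inside `F` only involves a finite `S ⊆ F`, where `hα`
bounds it by `(1 - α) w(S)`. -/
theorem IsConductance.mul_tsum_le_tsum_edgeBoundary (hc : IsConductance G w c) {α : ℝ}
    (hα : ∀ F : Finset V, α * ∑ x ∈ F, w x ≤ ∑ x ∈ F, w x - ∑ x ∈ F, ∑ y ∈ F, c x y)
    {F : Set V} (hne : F.Nonempty) (hF : Summable fun x : F => w x) :
    α * ∑' x : F, w x ≤ ∑' e : edgeBoundary G F, c e.1.1 e.1.2 := by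
  classical
  obtain ⟨o, -⟩ := hne
  -- Needed to enlarge `(1 - α) w(S)` to `(1 - α) w(F)`.
  have hα1 : α ≤ 1 := by
    have := hα {o}
    simp only [Finset.sum_singleton] at this
    have h0 := hc.weight_pos o
    have h1 := hc.nonneg o o
    by_contra hlt
    push Not at hlt
    nlinarith
  have hle : ∑' e, (F ×ˢ F).indicator (fun e : V × V => c e.1 e.2) e ≤
      (1 - α) * ∑' x : F, w x := by
    refine Real.tsum_le_of_sum_le
      (fun e => Set.indicator_nonneg (fun e _ => hc.nonneg _ _) e) fun u => ?_
    set S : Finset V := (u.image Prod.fst ∪ u.image Prod.snd).filter (· ∈ F)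
    have hSF : ∀ x ∈ S, x ∈ F := fun x hx => (Finset.mem_filter.1 hx).2
    calc _ = ∑ e ∈ u.filter (· ∈ F ×ˢ F), c e.1 e.2 := by
          rw [Finset.sum_filter]
          exact Finset.sum_congr rfl fun e _ => Set.indicator_apply _ _ _
      _ ≤ ∑ e ∈ S ×ˢ S, c e.1 e.2 := by
          refine Finset.sum_le_sum_of_subset_of_nonneg ?_ fun e _ _ => hc.nonneg _ _
          intro e he
          obtain ⟨he, h1, h2⟩ := Finset.mem_filter.1 he
          exact Finset.mem_product.2
            ⟨Finset.mem_filter.2 ⟨Finset.mem_union_left _ (Finset.mem_image_of_mem _ he), h1⟩,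
              Finset.mem_filter.2 ⟨Finset.mem_union_right _ (Finset.mem_image_of_mem _ he), h2⟩⟩
      _ ≤ (1 - α) * ∑ x ∈ S, w x := by
          rw [Finset.sum_product]
          linarith [hα S]
      _ ≤ _ := by
          refine mul_le_mul_of_nonneg_left ?_ (by linarith)
          rw [← Finset.sum_subtype_of_mem w hSF]
          exact hF.sum_le_tsum _ fun x _ => (hc.weight_pos x).le
  have := hc.tsum_edgeBoundary_add hF
  linarith

theorem exists_finset_coe_eq_vertexBoundary (G : SimpleGraph V) [G.LocallyFinite]
    (F : Finset V) : ∃ B : Finset V, (B : Set V) = vertexBoundary G (F : Set V) := by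
  classical
  have : (vertexBoundary G (F : Set V)).Finite := by
    refine (Finset.finite_toSet (F.biUnion fun x => G.neighborFinset x)).subset ?_
    rintro y ⟨-, x, hx, hxy⟩
    exact Finset.mem_coe.2 (Finset.mem_biUnion.2
      ⟨x, hx, (SimpleGraph.mem_neighborFinset _ _ _).2 hxy⟩)
  exact ⟨this.toFinset, this.coe_toFinset⟩

/-- Boundary edges are grouped by their outer endpoint, so that each `y ∈ B` can be compared with `w
y` separately. -/
theorem IsConductance.boundary_eq_sum_vertexBoundary (hc : IsConductance G w c) {F B : Finset V}
    (hB : (B : Set V) = vertexBoundary G (F : Set V)) :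
    ∑ x ∈ F, w x - ∑ x ∈ F, ∑ y ∈ F, c x y = ∑ y ∈ B, ∑ x ∈ F, c y x := by
  classical
  have hmem : ∀ y, y ∈ B ↔ y ∉ F ∧ ∃ x ∈ F, G.Adj x y := fun y => by
    rw [← Finset.mem_coe, hB]
    rfl
  have hdisj : Disjoint F B := Finset.disjoint_right.2 fun y hy => ((hmem y).1 hy).1
  rw [Finset.sum_comm (s := B), ← Finset.sum_sub_distrib]
  refine Finset.sum_congr rfl fun x hx => ?_
  have hN : G.neighborFinset x ⊆ F ∪ B := by
    intro y hy
    rw [SimpleGraph.mem_neighborFinset] at hy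
    by_cases hyF : y ∈ F
    · exact Finset.mem_union_left _ hyF
    · exact Finset.mem_union_right _ ((hmem y).2 ⟨hyF, x, hx, hy⟩)
  rw [← hc.sum_of_neighborFinset_subset hN, Finset.sum_union hdisj, add_sub_cancel_left]
  exact Finset.sum_congr rfl fun y _ => hc.symm x y

theorem IsConductance.boundary_le_vertexBoundary (hc : IsConductance G w c) {F B : Finset V}
    (hB : (B : Set V) = vertexBoundary G (F : Set V)) :
    ∑ x ∈ F, w x - ∑ x ∈ F, ∑ y ∈ F, c x y ≤ ∑ y ∈ B, w y := by
  rw [hc.boundary_eq_sum_vertexBoundary hB]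
  exact Finset.sum_le_sum fun y _ => hc.sum_le y F

theorem IsConductance.vertexBoundary_le_boundary (hc : IsConductance G w c) {δ : ℝ}
    (hδ : ∀ x y, G.Adj x y → δ * w x ≤ c x y) {F B : Finset V}
    (hB : (B : Set V) = vertexBoundary G (F : Set V)) :
    δ * ∑ y ∈ B, w y ≤ ∑ x ∈ F, w x - ∑ x ∈ F, ∑ y ∈ F, c x y := by
  rw [hc.boundary_eq_sum_vertexBoundary hB, Finset.mul_sum]
  refine Finset.sum_le_sum fun y hy => ?_
  rw [← Finset.mem_coe, hB] at hy
  obtain ⟨-, x, hx, hxy⟩ := hy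
  exact (hδ y x hxy.symm).trans (Finset.single_le_sum (fun x _ => hc.nonneg y x) hx)

end Conductance

/-! ### The biased walk, its expansion constants and its spectral radius. -/

section Walk

theorem relWeight_self (hG : G.Connected) (Γ : Subgroup (G ≃g G)) (o : V) :
    relWeight Γ o o = 1 := by
  have h := relWeight_mul_relWeight hG Γ o o o
  exact mul_right_cancel₀ (relWeight_pos hG Γ o o).ne' (h.trans (one_mul _).symm)

theorem relWeight_smul_eq (hG : G.Connected) (Γ : Subgroup (G ≃g G)) (γ : Γ) (o z : V) :
    relWeight Γ o (γ • z) = relWeight Γ o (γ • o) * relWeight Γ o z := by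
  have := relWeight_smul hG Γ γ o o z
  rwa [relWeight_self hG, mul_one] at this

theorem sqrt_relWeight_smul (hG : G.Connected) (Γ : Subgroup (G ≃g G)) (γ : Γ) (o x y : V) :
    √(relWeight Γ o (γ • x) * relWeight Γ o (γ • y)) =
      relWeight Γ o (γ • o) * √(relWeight Γ o x * relWeight Γ o y) := by
  have h := (relWeight_pos hG Γ o (γ • o)).le
  rw [relWeight_smul_eq hG Γ γ o x, relWeight_smul_eq hG Γ γ o y, mul_mul_mul_comm,
    Real.sqrt_mul (mul_self_nonneg _), Real.sqrt_mul_self h]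

/-- An element taking `o` to `x` scales the sum at `o` by `w^o(x)`; this is why dividing by `D`
yields total conductance `w^o(x)`. -/
theorem sum_sqrt_relWeight (hG : G.Connected) (Γ : Subgroup (G ≃g G))
    (htrans : MulAction.IsPretransitive Γ V) (o x : V) :
    ∑ z ∈ G.neighborFinset x, √(relWeight Γ o x * relWeight Γ o z) =
      relWeight Γ o x * sqrtDegree Γ o := by
  obtain ⟨γ, rfl⟩ := htrans.exists_smul_eq o x
  rw [neighborFinset_smul, Finset.sum_map, sqrtDegree, Finset.mul_sum]
  refine Finset.sum_congr rfl fun z _ => ?_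
  rw [Function.Embedding.coeFn_mk, sqrt_relWeight_smul hG, relWeight_self hG, one_mul]

theorem sqrtDegree_pos [Nontrivial V] (hG : G.Connected) (Γ : Subgroup (G ≃g G)) (o : V) :
    0 < sqrtDegree Γ o := by
  obtain ⟨z, hz⟩ := hG.preconnected.exists_adj_of_nontrivial o
  exact Finset.sum_pos (fun z _ => Real.sqrt_pos.2 (relWeight_pos hG Γ o z))
    ⟨z, (SimpleGraph.mem_neighborFinset _ _ _).2 hz⟩

open Classical in
/-- The conductance extended by zero to pairs of vertices that are not adjacent. -/
def edgeConductance (Γ : Subgroup (G ≃g G)) (o x y : V) : ℝ :=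
  if G.Adj x y then conductance Γ o x y else 0

theorem nStepProb_eq_pow_markovOp (Γ : Subgroup (G ≃g G)) (o : V) (n : ℕ) (x y : V) :
    nStepProb Γ o n x y = (markovOp G (stepProb Γ o) ^ n) (Finsupp.single y 1) x := by
  classical
  induction n generalizing x with
  | zero => simp [nStepProb, Finsupp.single_apply, eq_comm]
  | succ n ih =>
    rw [nStepProb, pow_succ', Module.End.mul_apply, markovOp_apply]
    exact Finset.sum_congr rfl fun z _ => by rw [ih]

theorem tsum_conductance_edgeBoundary (Γ : Subgroup (G ≃g G)) (o : V) (F : Set V) :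
    ∑' e : edgeBoundary G F, conductance Γ o e.1.1 e.1.2 =
      ∑' e : edgeBoundary G F, edgeConductance Γ o e.1.1 e.1.2 :=
  tsum_congr fun e => (if_pos e.2.2.2).symm

theorem setWeight_pos (hG : G.Connected) (Γ : Subgroup (G ≃g G)) (o : V) {F : Set V}
    (hne : F.Nonempty) (hF : IsLight Γ o F) : 0 < setWeight Γ o F := by
  obtain ⟨x, hx⟩ := hne
  exact hF.tsum_pos (fun x => (relWeight_pos hG Γ o x).le) ⟨x, hx⟩ (relWeight_pos hG Γ o x)

theorem vertexExpansion_le (hG : G.Connected) (Γ : Subgroup (G ≃g G)) (o : V) {F B : Finset V}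
    (hF : F.Nonempty) (hB : (B : Set V) = vertexBoundary G (F : Set V)) :
    vertexExpansion Γ o * ∑ x ∈ F, relWeight Γ o x ≤ ∑ y ∈ B, relWeight Γ o y := by
  rw [← setWeight_coe, ← setWeight_coe, hB, ← le_div_iff₀
    (setWeight_pos hG Γ o (Finset.coe_nonempty.2 hF) Summable.of_finite)]
  refine ciInf_le (f := fun F : {F : Set V // F.Finite ∧ F.Nonempty} =>
    setWeight Γ o (vertexBoundary G F.1) / setWeight Γ o F.1) ⟨0, ?_⟩
    ⟨(F : Set V), F.finite_toSet, Finset.coe_nonempty.2 hF⟩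
  rintro _ ⟨A, rfl⟩
  exact div_nonneg (tsum_nonneg fun x => (relWeight_pos hG Γ o x).le)
    (tsum_nonneg fun x => (relWeight_pos hG Γ o x).le)

variable [Nontrivial V]

theorem relWeight_mul_stepProb (hG : G.Connected) (Γ : Subgroup (G ≃g G))
    (htrans : MulAction.IsPretransitive Γ V) (o x y : V) :
    relWeight Γ o x * stepProb Γ o x y = edgeConductance Γ o x y := by
  rw [stepProb, edgeConductance]
  split_ifs
  · rw [sum_sqrt_relWeight hG Γ htrans, conductance]
    have := (relWeight_pos hG Γ o x).ne'
    have := (sqrtDegree_pos hG Γ o).ne'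
    field_simp
  · rw [mul_zero]

theorem isConductance_edgeConductance (hG : G.Connected) (Γ : Subgroup (G ≃g G))
    (htrans : MulAction.IsPretransitive Γ V) (o : V) :
    IsConductance G (relWeight Γ o) (edgeConductance Γ o) where
  weight_pos := relWeight_pos hG Γ o
  nonneg x y := by
    rw [edgeConductance]
    split_ifs
    · exact div_nonneg (Real.sqrt_nonneg _) (sqrtDegree_pos hG Γ o).le
    · exact le_rfl
  symm x y := by
    rw [edgeConductance, edgeConductance, conductance, conductance, G.adj_comm,
      mul_comm (relWeight Γ o x)]
  eq_zero x y h := if_neg h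
  sum_eq x := by
    have : ∀ y ∈ G.neighborFinset x, edgeConductance Γ o x y =
        √(relWeight Γ o x * relWeight Γ o y) / sqrtDegree Γ o := fun y hy =>
      if_pos ((SimpleGraph.mem_neighborFinset _ _ _).1 hy)
    rw [Finset.sum_congr rfl this, ← Finset.sum_div, sum_sqrt_relWeight hG Γ htrans,
      mul_div_cancel_right₀ _ (sqrtDegree_pos hG Γ o).ne']

/-- Weight and conductance are scaled by the same factor `w^o(γ o)`, which cancels. -/
theorem stepProb_smul_smul (hG : G.Connected) (Γ : Subgroup (G ≃g G))
    (htrans : MulAction.IsPretransitive Γ V) (γ : Γ) (o x y : V) :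
    stepProb Γ o (γ • x) (γ • y) = stepProb Γ o x y := by
  refine mul_left_cancel₀ (relWeight_pos hG Γ o (γ • x)).ne' ?_
  rw [relWeight_mul_stepProb hG Γ htrans, relWeight_smul_eq hG, mul_assoc,
    relWeight_mul_stepProb hG Γ htrans, edgeConductance, edgeConductance, adj_smul_smul]
  split_ifs
  · rw [conductance, sqrt_relWeight_smul hG, mul_div_assoc, conductance]
  · rw [mul_zero]

theorem nStepProb_smul_smul (hG : G.Connected) (Γ : Subgroup (G ≃g G))
    (htrans : MulAction.IsPretransitive Γ V) (γ : Γ) (o : V) (n : ℕ) (x y : V) :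
    nStepProb Γ o n (γ • x) (γ • y) = nStepProb Γ o n x y := by
  induction n generalizing x with
  | zero =>
    classical
    simp only [nStepProb]
    exact if_congr (smul_left_cancel_iff γ) rfl rfl
  | succ n ih =>
    rw [nStepProb, nStepProb, neighborFinset_smul, Finset.sum_map]
    refine Finset.sum_congr rfl fun z _ => ?_
    rw [Function.Embedding.coeFn_mk, stepProb_smul_smul hG Γ htrans, ih]

theorem nStepProb_self_eq (hG : G.Connected) (Γ : Subgroup (G ≃g G))
    (htrans : MulAction.IsPretransitive Γ V) (o x : V) (n : ℕ) :
    nStepProb Γ o n x x = nStepProb Γ o n o o := by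
  obtain ⟨γ, rfl⟩ := htrans.exists_smul_eq o x
  exact nStepProb_smul_smul hG Γ htrans γ o n o o

/-- By invariance every step probability along an edge already occurs among the finitely many at
`o`; `δ` is their minimum. -/
theorem exists_mul_relWeight_le_edgeConductance (hG : G.Connected) (Γ : Subgroup (G ≃g G))
    (htrans : MulAction.IsPretransitive Γ V) (o : V) :
    ∃ δ > 0, ∀ x y, G.Adj x y → δ * relWeight Γ o x ≤ edgeConductance Γ o x y := by
  obtain ⟨z₀, hz₀⟩ := hG.preconnected.exists_adj_of_nontrivial o
  obtain ⟨z, hz, hmin⟩ := (G.neighborFinset o).exists_min_image (stepProb Γ o o)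
    ⟨z₀, (SimpleGraph.mem_neighborFinset _ _ _).2 hz₀⟩
  rw [SimpleGraph.mem_neighborFinset] at hz
  have hD := sqrtDegree_pos hG Γ o
  have hpos : 0 < stepProb Γ o o z := by
    rw [stepProb, if_pos hz, sum_sqrt_relWeight hG Γ htrans]
    exact div_pos (Real.sqrt_pos.2 (mul_pos (relWeight_pos hG Γ o o) (relWeight_pos hG Γ o z)))
      (mul_pos (relWeight_pos hG Γ o o) hD)
  refine ⟨_, hpos, fun x y hxy => ?_⟩
  rw [← relWeight_mul_stepProb hG Γ htrans, mul_comm]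
  refine mul_le_mul_of_nonneg_left ?_ (relWeight_pos hG Γ o x).le
  obtain ⟨γ, rfl⟩ := htrans.exists_smul_eq o x
  obtain ⟨u, rfl⟩ := MulAction.surjective γ y
  rw [adj_smul_smul] at hxy
  rw [stepProb_smul_smul hG Γ htrans]
  exact hmin u ((SimpleGraph.mem_neighborFinset _ _ _).2 hxy)

/-- Finite sets suffice as tests, although the infimum runs over all light sets. -/
theorem le_edgeExpansion (hG : G.Connected) (Γ : Subgroup (G ≃g G))
    (htrans : MulAction.IsPretransitive Γ V) (o : V) {α : ℝ}
    (hα : ∀ F : Finset V, α * ∑ x ∈ F, relWeight Γ o x ≤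
      ∑ x ∈ F, relWeight Γ o x - ∑ x ∈ F, ∑ y ∈ F, edgeConductance Γ o x y) :
    α ≤ edgeExpansion Γ o := by
  have : Nonempty {F : Set V // F.Nonempty ∧ IsLight Γ o F} :=
    ⟨⟨{o}, Set.singleton_nonempty o, Summable.of_finite⟩⟩
  refine le_ciInf fun ⟨F, hne, hF⟩ => ?_
  rw [le_div_iff₀ (setWeight_pos hG Γ o hne hF), tsum_conductance_edgeBoundary]
  exact (isConductance_edgeConductance hG Γ htrans o).mul_tsum_le_tsum_edgeBoundary hα hne hF

theorem edgeExpansion_mul_le (hG : G.Connected) (Γ : Subgroup (G ≃g G))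
    (htrans : MulAction.IsPretransitive Γ V) (o : V) (F : Finset V) :
    edgeExpansion Γ o * ∑ x ∈ F, relWeight Γ o x ≤
      ∑ x ∈ F, relWeight Γ o x - ∑ x ∈ F, ∑ y ∈ F, edgeConductance Γ o x y := by
  rcases F.eq_empty_or_nonempty with rfl | hne
  · simp
  have hc := isConductance_edgeConductance hG Γ htrans o
  have hl : IsLight Γ o (F : Set V) := Summable.of_finite
  have hpos := setWeight_pos hG Γ o (Finset.coe_nonempty.2 hne) hl
  rw [← hc.tsum_edgeBoundary_coe, ← setWeight_coe, ← le_div_iff₀ hpos,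
    ← tsum_conductance_edgeBoundary]
  refine ciInf_le (f := fun F : {F : Set V // F.Nonempty ∧ IsLight Γ o F} =>
    (∑' e : edgeBoundary G F.1, conductance Γ o e.1.1 e.1.2) / setWeight Γ o F.1) ⟨0, ?_⟩
    ⟨(F : Set V), Finset.coe_nonempty.2 hne, hl⟩
  rintro _ ⟨⟨A, hA, hA'⟩, rfl⟩
  refine div_nonneg ?_ (setWeight_pos hG Γ o hA hA').le
  change 0 ≤ ∑' e : edgeBoundary G A, conductance Γ o e.1.1 e.1.2
  rw [tsum_conductance_edgeBoundary]
  exact tsum_nonneg fun e => hc.nonneg _ _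

theorem edgeExpansion_nonneg (hG : G.Connected) (Γ : Subgroup (G ≃g G))
    (htrans : MulAction.IsPretransitive Γ V) (o : V) : 0 ≤ edgeExpansion Γ o := by
  refine le_edgeExpansion hG Γ htrans o fun F => ?_
  rw [zero_mul, sub_nonneg]
  exact Finset.sum_le_sum fun x _ => (isConductance_edgeConductance hG Γ htrans o).sum_le x F

theorem edgeExpansion_le_one (hG : G.Connected) (Γ : Subgroup (G ≃g G))
    (htrans : MulAction.IsPretransitive Γ V) (o : V) : edgeExpansion Γ o ≤ 1 := by
  have h := edgeExpansion_mul_le hG Γ htrans o {o}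
  have h0 := (isConductance_edgeConductance hG Γ htrans o).nonneg o o
  simp only [Finset.sum_singleton, relWeight_self hG] at h
  linarith

theorem edgeExpansion_le_vertexExpansion (hG : G.Connected) (Γ : Subgroup (G ≃g G))
    (htrans : MulAction.IsPretransitive Γ V) (o : V) :
    edgeExpansion Γ o ≤ vertexExpansion Γ o := by
  have : Nonempty {F : Set V // F.Finite ∧ F.Nonempty} :=
    ⟨⟨{o}, Set.finite_singleton o, Set.singleton_nonempty o⟩⟩
  refine le_ciInf fun ⟨A, hfin, hne⟩ => ?_
  lift A to Finset V using hfin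
  obtain ⟨B, hB⟩ := exists_finset_coe_eq_vertexBoundary G A
  rw [le_div_iff₀ (setWeight_pos hG Γ o hne Summable.of_finite)]
  change _ * setWeight Γ o (A : Set V) ≤ setWeight Γ o (vertexBoundary G (A : Set V))
  rw [← hB, setWeight_coe, setWeight_coe]
  exact (edgeExpansion_mul_le hG Γ htrans o A).trans
    ((isConductance_edgeConductance hG Γ htrans o).boundary_le_vertexBoundary hB)

theorem wAmenable_iff_edgeExpansion_eq_zero (hG : G.Connected) (Γ : Subgroup (G ≃g G))
    (htrans : MulAction.IsPretransitive Γ V) (o : V) :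
    WAmenable Γ o ↔ edgeExpansion Γ o = 0 := by
  have h0 := edgeExpansion_nonneg hG Γ htrans o
  have h1 := edgeExpansion_le_vertexExpansion hG Γ htrans o
  rw [WAmenable]
  refine ⟨fun h => le_antisymm (h ▸ h1) h0, fun h => le_antisymm ?_ (h0.trans h1)⟩
  obtain ⟨δ, hδ, hle⟩ := exists_mul_relWeight_le_edgeConductance hG Γ htrans o
  -- It suffices that `δ` times the vertex constant is a lower bound for the edge constant.
  refine nonpos_of_mul_nonpos_right (a := δ) ?_ hδ
  rw [← h]
  refine le_edgeExpansion hG Γ htrans o fun F => ?_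
  rcases F.eq_empty_or_nonempty with rfl | hne
  · simp
  obtain ⟨B, hB⟩ := exists_finset_coe_eq_vertexBoundary G F
  rw [mul_assoc]
  exact (mul_le_mul_of_nonneg_left (vertexExpansion_le hG Γ o hne hB) hδ.le).trans
    ((isConductance_edgeConductance hG Γ htrans o).vertexBoundary_le_boundary hle hB)

theorem nStepProb_two_mul_nonneg (hG : G.Connected) (Γ : Subgroup (G ≃g G))
    (htrans : MulAction.IsPretransitive Γ V) (o x : V) (n : ℕ) :
    0 ≤ nStepProb Γ o (2 * n) x x := by
  rw [nStepProb_eq_pow_markovOp]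
  exact (isConductance_edgeConductance hG Γ htrans o).pow_markovOp_apply_self_nonneg
    (relWeight_mul_stepProb hG Γ htrans o) x n

theorem nStepProb_two_mul_le (hG : G.Connected) (Γ : Subgroup (G ≃g G))
    (htrans : MulAction.IsPretransitive Γ V) (o x : V) (n : ℕ) :
    nStepProb Γ o (2 * n) x x ≤ √(1 - edgeExpansion Γ o ^ 2) ^ (2 * n) := by
  rw [nStepProb_eq_pow_markovOp]
  exact (isConductance_edgeConductance hG Γ htrans o).pow_markovOp_apply_self_le
    (relWeight_mul_stepProb hG Γ htrans o) (edgeExpansion_nonneg hG Γ htrans o)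
    (edgeExpansion_le_one hG Γ htrans o) (edgeExpansion_mul_le hG Γ htrans o) x n

theorem spectralRadius_le (hG : G.Connected) (Γ : Subgroup (G ≃g G))
    (htrans : MulAction.IsPretransitive Γ V) (o x : V) :
    spectralRadius Γ o x ≤ √(1 - edgeExpansion Γ o ^ 2) :=
  limsup_root_le (Real.sqrt_nonneg _) (nStepProb_two_mul_nonneg hG Γ htrans o x)
    (nStepProb_two_mul_le hG Γ htrans o x)

theorem le_spectralRadius (hG : G.Connected) (Γ : Subgroup (G ≃g G))
    (htrans : MulAction.IsPretransitive Γ V) (o x : V) {r C : ℝ} (hr : 0 ≤ r) (hC : 0 < C)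
    (hle : ∀ n, C * r ^ (2 * n) ≤ nStepProb Γ o (2 * n) x x) : r ≤ spectralRadius Γ o x :=
  le_limsup_root (Real.sqrt_nonneg _) (nStepProb_two_mul_nonneg hG Γ htrans o x)
    (nStepProb_two_mul_le hG Γ htrans o x) hr hC hle

theorem spectralRadius_nonneg (hG : G.Connected) (Γ : Subgroup (G ≃g G))
    (htrans : MulAction.IsPretransitive Γ V) (o x : V) : 0 ≤ spectralRadius Γ o x := by
  refine le_spectralRadius hG Γ htrans o x le_rfl one_pos fun n => ?_
  -- With `r = 0`, the case `n = 0` reads `0 ^ 0 = 1 ≤ p_0(x,x) = 1`.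
  rcases Nat.eq_zero_or_pos n with rfl | hn
  · simp [nStepProb]
  · rw [zero_pow (by omega), mul_zero]
    exact nStepProb_two_mul_nonneg hG Γ htrans o x n

theorem one_sub_spectralRadius_le (hG : G.Connected) (Γ : Subgroup (G ≃g G))
    (htrans : MulAction.IsPretransitive Γ V) (o x : V) :
    1 - spectralRadius Γ o x ≤ edgeExpansion Γ o := by
  have hc := isConductance_edgeConductance hG Γ htrans o
  have hp := relWeight_mul_stepProb hG Γ htrans o
  refine le_edgeExpansion hG Γ htrans o fun F => ?_
  suffices h : ∑ x ∈ F, ∑ y ∈ F, edgeConductance Γ o x y ≤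
      spectralRadius Γ o x * ∑ x ∈ F, relWeight Γ o x by linarith
  rcases F.eq_empty_or_nonempty with rfl | hne
  · simp
  have hW : 0 < ∑ x ∈ F, relWeight Γ o x := Finset.sum_pos (fun x _ => hc.weight_pos x) hne
  rw [← div_le_iff₀ hW]
  -- The candidate for `r` is the Rayleigh quotient of `F`; the iteration requires it to be
  -- positive.
  rcases le_or_gt ((∑ x ∈ F, ∑ y ∈ F, edgeConductance Γ o x y) / ∑ x ∈ F, relWeight Γ o x) 0
    with hr | hr
  · exact hr.trans (spectralRadius_nonneg hG Γ htrans o x)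
  obtain ⟨C, hC, hle⟩ := hc.exists_le_pow_markovOp_apply_self hp o
    (fun y n => by
      rw [← nStepProb_eq_pow_markovOp, ← nStepProb_eq_pow_markovOp,
        nStepProb_self_eq hG Γ htrans]) F hne hr (div_mul_cancel₀ _ hW.ne').le
  refine le_spectralRadius hG Γ htrans o x hr.le hC fun n => ?_
  rw [nStepProb_self_eq hG Γ htrans, nStepProb_eq_pow_markovOp]
  exact hle n

theorem sum_stepProb (hG : G.Connected) (Γ : Subgroup (G ≃g G))
    (htrans : MulAction.IsPretransitive Γ V) (o x : V) :
    ∑ y ∈ G.neighborFinset x, stepProb Γ o x y = 1 := by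
  refine mul_left_cancel₀ (relWeight_pos hG Γ o x).ne' ?_
  rw [Finset.mul_sum, mul_one]
  simp_rw [relWeight_mul_stepProb hG Γ htrans]
  exact (isConductance_edgeConductance hG Γ htrans o).sum_eq x

end Walk

end

end WeightedKesten

end

theorem mainTheorem8 {V : Type*} [Nontrivial V] (G : SimpleGraph V) [G.LocallyFinite]
    (hG : G.Connected) (Γ : Subgroup (G ≃g G))
    (hclosed : IsClosed[WeightedKesten.autTopology G] (Γ : Set (G ≃g G)))
    (htrans : MulAction.IsPretransitive Γ V) (o : V) :
    -- the walk is a Markov chain, reversible with respect to the measure `w^o`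
    (∀ x, ∑ y ∈ G.neighborFinset x, WeightedKesten.stepProb Γ o x y = 1) ∧
    (∀ x y, WeightedKesten.relWeight Γ o x * WeightedKesten.stepProb Γ o x y =
      WeightedKesten.relWeight Γ o y * WeightedKesten.stepProb Γ o y x) ∧
    -- the spectral radius (for every starting vertex `x`)
    (∀ x,
      (1 / 2) * WeightedKesten.edgeExpansion Γ o ^ 2 ≤
          1 - √(1 - WeightedKesten.edgeExpansion Γ o ^ 2) ∧
      1 - √(1 - WeightedKesten.edgeExpansion Γ o ^ 2) ≤
          1 - WeightedKesten.spectralRadius Γ o x ∧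
      1 - WeightedKesten.spectralRadius Γ o x ≤ WeightedKesten.edgeExpansion Γ o ∧
      (WeightedKesten.spectralRadius Γ o x = 1 ↔ WeightedKesten.WAmenable Γ o)) := by
  have hc := WeightedKesten.isConductance_edgeConductance hG Γ htrans o
  refine ⟨WeightedKesten.sum_stepProb hG Γ htrans o, fun x y => ?_, fun x => ?_⟩
  · rw [WeightedKesten.relWeight_mul_stepProb hG Γ htrans,
      WeightedKesten.relWeight_mul_stepProb hG Γ htrans, hc.symm]
  · have h0 := WeightedKesten.edgeExpansion_nonneg hG Γ htrans o
    have h1 := WeightedKesten.edgeExpansion_le_one hG Γ htrans o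
    have hle := WeightedKesten.spectralRadius_le hG Γ htrans o x
    have hge := WeightedKesten.one_sub_spectralRadius_le hG Γ htrans o x
    rw [WeightedKesten.wAmenable_iff_edgeExpansion_eq_zero hG Γ htrans]
    set Φ := WeightedKesten.edgeExpansion Γ o
    -- This is `√(1 - t) ≤ 1 - t / 2` at `t = Φ ^ 2`. It also forces `Φ = 0` when the spectral
    -- radius is `1`.
    have hsq : √(1 - Φ ^ 2) ≤ 1 - 1 / 2 * Φ ^ 2 := by
      refine Real.sqrt_le_iff.2 ⟨by nlinarith, ?_⟩
      nlinarith [sq_nonneg (Φ ^ 2)]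
    refine ⟨by linarith, by linarith, hge, fun h => ?_, fun h => ?_⟩
    · have : Φ ^ 2 = 0 := le_antisymm (by linarith) (sq_nonneg Φ)
      exact pow_eq_zero_iff two_ne_zero |>.1 this
    · rw [h] at hle hge
      norm_num at hle
      linarith
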